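/- Let $n\ge 1$ and let integers $a_i\le b_i$ ($0\le i\le n$) satisfy $a_0=0$, $0\le a_1-a_0\le a_2-a_1\le\dots\le a_n-a_{n-1}\le 1$ and $1\ge b_1-b_0\ge b_2-b_1\ge\dots\ge b_n-b_{n-1}\ge 0$ (a convex configuration). Put $V=\{(i,j)\in\mathbb Z^2: 0\le i\le n,\ a_i\le j\le b_i\}$, and for $X=(x_{ij})\in\mathbb R^V$ put $\partial x_{ij}=x_{ij}-x_{i,j-1}$ for $0\le i\le n$, $a_i<j\le b_i$. Call $X$ strip-concave if for every $1\le i\le n$ $$\partial x_{ij}\ge\partial x_{i-1,j}\quad (a_i<j\le b_{i-1})\qquad\text{and}\qquad \partial x_{i-1,j}\ge\partial x_{i,j+1}\quad (a_{i-1}<j<b_i).$$ For integer tuples $\lambda=(\lambda_{a_n+1},\dots,\lambda_{b_n})$, $\overline\lambda=(\overline\lambda_1,\dots,\overline\lambda_{b_0})$ and $\mu=(\mu_1,\dots,\mu_n)$, let $SC(\lambda\setminus\overline\lambda,\mu)\subset\mathbb R^V$ be the polyhedron of all strip-concave $X$ with $x_{00}=0$, with $\partial x_{nj}=\lambda_j$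 for $a_n<j\le b_n$, with $\partial x_{0j}=\overline\lambda_j$ for $1\le j\le b_0$, and with $x_{i,a_i}-x_{i-1,a_{i-1}}=\mu_i$ for $1\le i\le n$. Then $SC(\lambda\setminus\overline\lambda,\mu)$ is integral: every nonempty face of it (i.e. every nonempty set of all maximizers over the polyhedron of some linear functional, the polyhedron itself included when it is nonempty) contains a point all of whose coordinates are integers. -/

import Mathlib

/-- A convex configuration with rows `0, …, n`: row `i` consists of the integer positions `j` with
`a i ≤ j ≤ b i`; only the values of `a`, `b` at arguments `≤ n` matter. The left ends start at `0`,
the increments `a (i+1) - a i` are weakly increasing integers between `0` and `1`, and the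
increments `b (i+1) - b i` are weakly decreasing integers between `0` and `1`. -/
structure ConvexConfiguration (n : ℕ) where
  a : ℕ → ℤ
  b : ℕ → ℤ
  a_le_b : ∀ i, i ≤ n → a i ≤ b i
  a_zero : a 0 = 0
  a_step_nonneg : ∀ i, i < n → 0 ≤ a (i + 1) - a i
  a_step_le_one : ∀ i, i < n → a (i + 1) - a i ≤ 1
  a_step_mono : ∀ i, i + 1 < n → a (i + 1) - a i ≤ a (i + 2) - a (i + 1)
  b_step_nonneg : ∀ i, i < n → 0 ≤ b (i + 1) - b i
  b_step_le_one : ∀ i, i < n → b (i + 1) - b i ≤ 1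
  b_step_anti : ∀ i, i + 1 < n → b (i + 2) - b (i + 1) ≤ b (i + 1) - b i

namespace ConvexConfiguration

/-- The set `V` of index pairs `(i, j)` of a convex configuration. -/
def Idx {n : ℕ} (C : ConvexConfiguration n) : Type :=
  {p : ℕ × ℤ // p.1 ≤ n ∧ C.a p.1 ≤ p.2 ∧ p.2 ≤ C.b p.1}

open Classical in
/-- The entry `x_{ij}` of an array `X ∈ ℝ^V`. It is only used for `(i, j) ∈ V`; elsewhere the
value is set to `0`. -/
noncomputable def entry {n : ℕ} (C : ConvexConfiguration n) (X : C.Idx → ℝ) (i : ℕ) (j : ℤ) : ℝ :=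
  if h : i ≤ n ∧ C.a i ≤ j ∧ j ≤ C.b i then X ⟨(i, j), h⟩ else 0

/-- The row derivative `∂x_{ij} = x_{ij} - x_{i,j-1}`, used for `i ≤ n`, `a i < j ≤ b i`. -/
noncomputable def rowDeriv {n : ℕ} (C : ConvexConfiguration n) (X : C.Idx → ℝ)
    (i : ℕ) (j : ℤ) : ℝ :=
  C.entry X i j - C.entry X i (j - 1)

/-- Strip-concavity: both kinds of rhombus inequalities between the consecutive rows `i` and
`i + 1`, for all rhombi contained in `V`. The ranges of `j` say precisely that the two row
derivatives being compared are both defined. -/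
def IsStripConcave {n : ℕ} (C : ConvexConfiguration n) (X : C.Idx → ℝ) : Prop :=
  ∀ i, i < n →
    (∀ j, C.a (i + 1) < j → j ≤ C.b i → C.rowDeriv X i j ≤ C.rowDeriv X (i + 1) j) ∧
    (∀ j, C.a i < j → j < C.b (i + 1) → C.rowDeriv X (i + 1) (j + 1) ≤ C.rowDeriv X i j)

/-- The polyhedral cone of strip-concave arrays normalized by `x_{00} = 0`. -/
def stripConcaveCone {n : ℕ} (C : ConvexConfiguration n) : Set (C.Idx → ℝ) :=
  {X | C.IsStripConcave X ∧ C.entry X 0 0 = 0}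

/-- The polyhedron of normalized strip-concave arrays with prescribed local differences on the
lower boundary (`lam j` for `a n < j ≤ b n`), on the upper boundary (`lamBar j` for
`0 < j ≤ b 0`) and on the left boundary (`mu i` for `1 ≤ i ≤ n`). Other values of `lam`, `lamBar`,
`mu` play no role. -/
def stripConcavePolyhedron {n : ℕ} (C : ConvexConfiguration n)
    (lam lamBar : ℤ → ℝ) (mu : ℕ → ℝ) : Set (C.Idx → ℝ) :=
  {X | X ∈ C.stripConcaveCone ∧
    (∀ j, C.a n < j → j ≤ C.b n → C.rowDeriv X n j = lam j) ∧
    (∀ j, 0 < j → j ≤ C.b 0 → C.rowDeriv X 0 j = lamBar j) ∧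
    (∀ i, 1 ≤ i → i ≤ n → C.entry X i (C.a i) - C.entry X (i - 1) (C.a (i - 1)) = mu i)}

end ConvexConfiguration

/-- Every nonempty face of `P ⊆ ℝ^ι` (the set of maximizers over `P` of a linear functional; the
zero functional gives `P` itself) contains a point with integer coordinates. -/
def EveryFaceHasIntegerPoint {ι : Type*} (P : Set (ι → ℝ)) : Prop :=
  ∀ F : Set (ι → ℝ), IsExposed ℝ P F → F.Nonempty →
    ∃ X ∈ F, ∀ v, ∃ k : ℤ, X v = (k : ℝ)

/-!
The left boundary conditions and `x₀₀ = 0` determine the leftmost entries `x_{i,a_i}`, which are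
integers, and the remaining freedom is in the row derivatives `∂x_{ij}`. On these, all remaining
constraints are order relations between two derivatives and equations fixing a derivative to an
integer.

Both types of constraint survive the simultaneous rounding `y ↦ ⌊y + t⌋` of all row derivatives,
for any `t ∈ [0, 1)`: this map is monotone and fixes the integers. So a point `X` of the
polyhedron gives an integer point `X_t = roundRows t X` of it for each such `t`
(`roundRows_mem`, `exists_int_roundRows`). Since `∫₀¹ ⌊y + t⌋ dt = y`, the average of the `X_t` over
`t ∈ [0, 1)` is `X` (`integral_roundRows`). If `X` maximizes a linear functional `l`, then the
average of `l X_t` equals `l X`, so some `X_t` satisfies `l X ≤ l X_t` and lies in the same face.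
-/

open MeasureTheory

/-- A uniformly random shift makes the floor an unbiased rounding. -/
theorem integral_floor_add (y : ℝ) :
    ∫ t in Set.Ico (0 : ℝ) 1, ((⌊y + t⌋ : ℤ) : ℝ) = y := by
  have hper : ∫ s in y..y + 1, Int.fract s = ∫ s in (0 : ℝ)..0 + 1, Int.fract s :=
    (Int.fract_periodic ℝ).intervalIntegral_add_eq y 0
  have hunit : ∫ s in (0 : ℝ)..0 + 1, Int.fract s = 1 / 2 := by
    have h : ∫ s in Set.Ico (0 : ℝ) 1, Int.fract s = ∫ s in Set.Ico (0 : ℝ) 1, s :=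
      setIntegral_congr_fun measurableSet_Ico fun s hs => Int.fract_eq_self.2 hs
    rw [zero_add, intervalIntegral.integral_of_le zero_le_one, ← integral_Ico_eq_integral_Ioc, h,
      integral_Ico_eq_integral_Ioc, ← intervalIntegral.integral_of_le zero_le_one, integral_id]
    norm_num
  have hint : IntervalIntegrable (fun s : ℝ => Int.fract s) volume y (y + 1) := by
    refine (intervalIntegrable_const (c := (1 : ℝ))).mono_fun
      measurable_fract.aestronglyMeasurable (Filter.Eventually.of_forall fun s => ?_)
    simp only [Real.norm_eq_abs, abs_one, Int.abs_fract]
    exact (Int.fract_lt_one s).le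
  calc ∫ t in Set.Ico (0 : ℝ) 1, ((⌊y + t⌋ : ℤ) : ℝ)
      = ∫ s in y..y + 1, ((⌊s⌋ : ℤ) : ℝ) := by
        rw [integral_Ico_eq_integral_Ioc, ← intervalIntegral.integral_of_le zero_le_one,
          intervalIntegral.integral_comp_add_left (fun s : ℝ => ((⌊s⌋ : ℤ) : ℝ)) y, add_zero]
    _ = ∫ s in y..y + 1, (s - Int.fract s) := by simp only [Int.self_sub_fract]
    _ = y := by
        rw [intervalIntegral.integral_sub intervalIntegral.intervalIntegrable_id hint, hper, hunit,
          integral_id]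
        ring

theorem integrable_floor_add (y : ℝ) :
    IntegrableOn (fun t : ℝ => ((⌊y + t⌋ : ℤ) : ℝ)) (Set.Ico 0 1) := by
  refine Measure.integrableOn_of_bounded (M := |(⌊y⌋ : ℝ)| + 1) (by simp) ?_ ?_
  · exact (by fun_prop : Measurable fun t : ℝ => ((⌊y + t⌋ : ℤ) : ℝ)).aestronglyMeasurable
  · refine (ae_restrict_mem measurableSet_Ico).mono fun t ht => ?_
    have h1 : ⌊y⌋ ≤ ⌊y + t⌋ := Int.floor_le_floor (by linarith [ht.1])
    have h2 : ⌊y + t⌋ ≤ ⌊y⌋ + 1 := by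
      rw [← Int.floor_add_one]
      exact Int.floor_le_floor (by linarith [ht.2])
    have h1' : (⌊y⌋ : ℝ) ≤ ⌊y + t⌋ := by exact_mod_cast h1
    have h2' : (⌊y + t⌋ : ℝ) ≤ ⌊y⌋ + 1 := by exact_mod_cast h2
    rw [Real.norm_eq_abs, abs_le]
    constructor <;> linarith [neg_abs_le (⌊y⌋ : ℝ), le_abs_self (⌊y⌋ : ℝ)]

theorem floor_intCast_add_of_mem_Ico {t : ℝ} (ht : t ∈ Set.Ico (0 : ℝ) 1) (k : ℤ) :
    ⌊(k : ℝ) + t⌋ = k := by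
  rw [Int.floor_intCast_add, Int.floor_eq_zero_iff.2 ht, add_zero]

theorem sum_Ioc_sub_one_telescope (f : ℤ → ℝ) {a j : ℤ} (h : a ≤ j) :
    f a + ∑ k ∈ Finset.Ioc a j, (f k - f (k - 1)) = f j := by
  induction j, h using Int.leInduction with
  | base => simp
  | succ m hm ih =>
    have hs : Finset.Ioc a (m + 1) = insert (m + 1) (Finset.Ioc a m) := by
      ext k; simp only [Finset.mem_Ioc, Finset.mem_insert]; omega
    rw [hs, Finset.sum_insert (by simp), add_sub_cancel_right]
    linarith

namespace ConvexConfiguration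

variable {n : ℕ} (C : ConvexConfiguration n)

instance : Finite C.Idx := by
  refine Set.Finite.to_subtype (Set.Finite.subset
    ((Finset.range (n + 1)).finite_toSet.biUnion fun i _ =>
      (Set.finite_singleton i).prod (Set.finite_Icc (C.a i) (C.b i))) fun p hp => ?_)
  simp only [Set.mem_iUnion, Set.mem_prod, Set.mem_singleton_iff, Set.mem_Icc]
  exact ⟨p.1, by simpa using Nat.lt_succ_of_le hp.1, rfl, hp.2⟩

theorem entry_of_mem (X : C.Idx → ℝ) {i : ℕ} {j : ℤ} (hi : i ≤ n) (ha : C.a i ≤ j)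
    (hb : j ≤ C.b i) : C.entry X i j = X ⟨(i, j), hi, ha, hb⟩ :=
  dif_pos ⟨hi, ha, hb⟩

/-- The array with the same leftmost entries as `X` and with every row derivative `y` of `X`
replaced by `⌊y + t⌋`. -/
noncomputable def roundRows (t : ℝ) (X : C.Idx → ℝ) : C.Idx → ℝ := fun v =>
  C.entry X v.1.1 (C.a v.1.1) +
    ∑ k ∈ Finset.Ioc (C.a v.1.1) v.1.2, ((⌊C.rowDeriv X v.1.1 k + t⌋ : ℤ) : ℝ)

theorem entry_roundRows (t : ℝ) (X : C.Idx → ℝ) {i : ℕ} {j : ℤ} (hi : i ≤ n) (ha : C.a i ≤ j)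
    (hb : j ≤ C.b i) :
    C.entry (C.roundRows t X) i j = C.entry X i (C.a i) +
      ∑ k ∈ Finset.Ioc (C.a i) j, ((⌊C.rowDeriv X i k + t⌋ : ℤ) : ℝ) :=
  C.entry_of_mem _ hi ha hb

theorem entry_roundRows_left (t : ℝ) (X : C.Idx → ℝ) {i : ℕ} (hi : i ≤ n) :
    C.entry (C.roundRows t X) i (C.a i) = C.entry X i (C.a i) := by
  rw [C.entry_roundRows t X hi le_rfl (C.a_le_b i hi), Finset.Ioc_self, Finset.sum_empty, add_zero]

theorem rowDeriv_roundRows (t : ℝ) (X : C.Idx → ℝ) {i : ℕ} {j : ℤ} (hi : i ≤ n)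
    (ha : C.a i < j) (hb : j ≤ C.b i) :
    C.rowDeriv (C.roundRows t X) i j = ((⌊C.rowDeriv X i j + t⌋ : ℤ) : ℝ) := by
  have hs : Finset.Ioc (C.a i) j = insert j (Finset.Ioc (C.a i) (j - 1)) := by
    ext k; simp only [Finset.mem_Ioc, Finset.mem_insert]; omega
  rw [rowDeriv, C.entry_roundRows t X hi ha.le hb,
    C.entry_roundRows t X hi (by omega) (by omega), hs, Finset.sum_insert (by simp)]
  ring

theorem isStripConcave_roundRows (t : ℝ) {X : C.Idx → ℝ} (hX : C.IsStripConcave X) :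
    C.IsStripConcave (C.roundRows t X) := by
  intro i hi
  have hi1 : i + 1 ≤ n := hi
  have ha0 := C.a_step_nonneg i hi
  have ha1 := C.a_step_le_one i hi
  have hb0 := C.b_step_nonneg i hi
  have hb1 := C.b_step_le_one i hi
  refine ⟨fun j hj hj' => ?_, fun j hj hj' => ?_⟩
  · rw [C.rowDeriv_roundRows t X hi.le (by omega) hj', C.rowDeriv_roundRows t X hi1 hj (by omega)]
    have := (hX i hi).1 j hj hj'
    exact_mod_cast Int.floor_le_floor (by linarith)
  · rw [C.rowDeriv_roundRows t X hi1 (by omega) (by omega),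
      C.rowDeriv_roundRows t X hi.le hj (by omega)]
    have := (hX i hi).2 j hj hj'
    exact_mod_cast Int.floor_le_floor (by linarith)

section Polyhedron

variable {C} {lam lamBar : ℤ → ℤ} {mu : ℕ → ℤ} {X : C.Idx → ℝ}

theorem roundRows_mem {t : ℝ} (ht : t ∈ Set.Ico (0 : ℝ) 1)
    (hX : X ∈ C.stripConcavePolyhedron (fun j => (lam j : ℝ)) (fun j => (lamBar j : ℝ))
      (fun i => (mu i : ℝ))) :
    C.roundRows t X ∈ C.stripConcavePolyhedron (fun j => (lam j : ℝ)) (fun j => (lamBar j : ℝ))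
      (fun i => (mu i : ℝ)) := by
  obtain ⟨⟨hconc, h0⟩, hlam, hbar, hmu⟩ := hX
  refine ⟨⟨C.isStripConcave_roundRows t hconc, ?_⟩, fun j hj hj' => ?_, fun j hj hj' => ?_,
    fun i hi hi' => ?_⟩
  · have h := C.entry_roundRows_left t X (Nat.zero_le n)
    rwa [C.a_zero, h0] at h
  · rw [C.rowDeriv_roundRows t X le_rfl hj hj', hlam j hj hj', floor_intCast_add_of_mem_Ico ht]
  · rw [C.rowDeriv_roundRows t X (Nat.zero_le n) (C.a_zero.symm ▸ hj) hj', hbar j hj hj',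
      floor_intCast_add_of_mem_Ico ht]
  · rw [C.entry_roundRows_left t X hi', C.entry_roundRows_left t X ((Nat.sub_le i 1).trans hi')]
    exact hmu i hi hi'

theorem exists_int_entry_left
    (hX : X ∈ C.stripConcavePolyhedron (fun j => (lam j : ℝ)) (fun j => (lamBar j : ℝ))
      (fun i => (mu i : ℝ))) {i : ℕ} (hi : i ≤ n) :
    ∃ k : ℤ, C.entry X i (C.a i) = (k : ℝ) := by
  induction i with
  | zero => exact ⟨0, by simpa [C.a_zero] using hX.1.2⟩
  | succ i ih =>
    obtain ⟨k, hk⟩ := ih (by omega)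
    have h := hX.2.2.2 (i + 1) (by omega) hi
    rw [Nat.add_sub_cancel, hk] at h
    exact ⟨mu (i + 1) + k, by push_cast; linarith⟩

theorem exists_int_roundRows
    (hX : X ∈ C.stripConcavePolyhedron (fun j => (lam j : ℝ)) (fun j => (lamBar j : ℝ))
      (fun i => (mu i : ℝ))) (t : ℝ) (v : C.Idx) :
    ∃ k : ℤ, C.roundRows t X v = (k : ℝ) := by
  obtain ⟨k, hk⟩ := exists_int_entry_left hX v.2.1
  exact ⟨k + ∑ j ∈ Finset.Ioc (C.a v.1.1) v.1.2, ⌊C.rowDeriv X v.1.1 j + t⌋, by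
    rw [roundRows, hk]; push_cast; rfl⟩

end Polyhedron

theorem integrable_roundRows (X : C.Idx → ℝ) (v : C.Idx) :
    IntegrableOn (fun t => C.roundRows t X v) (Set.Ico 0 1) :=
  (integrable_const _).add (integrable_finsetSum _ fun _ _ => integrable_floor_add _)

theorem integral_roundRows (X : C.Idx → ℝ) (v : C.Idx) :
    ∫ t in Set.Ico (0 : ℝ) 1, C.roundRows t X v = X v := by
  simp only [roundRows]
  rw [integral_add (integrable_const _)
      (integrable_finsetSum _ fun _ _ => integrable_floor_add _),
    integral_finsetSum _ fun _ _ => integrable_floor_add _]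
  simp only [integral_floor_add, rowDeriv]
  rw [setIntegral_const, measureReal_def, Real.volume_Ico, sub_zero, ENNReal.ofReal_one,
    ENNReal.toReal_one, one_smul, sum_Ioc_sub_one_telescope _ v.2.2.1]
  exact C.entry_of_mem X v.2.1 v.2.2.1 v.2.2.2

/-- The average of `l (roundRows t X)` over `t ∈ [0, 1)` is `l X`, so it is attained or exceeded. -/
theorem exists_le_roundRows (l : StrongDual ℝ (C.Idx → ℝ)) (X : C.Idx → ℝ) :
    ∃ t ∈ Set.Ico (0 : ℝ) 1, l X ≤ l (C.roundRows t X) := by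
  have := Fintype.ofFinite C.Idx
  have hint : IntegrableOn (fun t => C.roundRows t X) (Set.Ico (0 : ℝ) 1) :=
    Integrable.of_eval fun v => C.integrable_roundRows X v
  have hX : ∫ t in Set.Ico (0 : ℝ) 1, C.roundRows t X = X := by
    ext v
    rw [eval_integral fun v => C.integrable_roundRows X v, C.integral_roundRows]
  have : IsProbabilityMeasure (volume.restrict (Set.Ico (0 : ℝ) 1)) := ⟨by simp⟩
  obtain ⟨t, ht, hle⟩ := exists_notMem_null_integral_le (l.integrable_comp hint)
    (show volume.restrict (Set.Ico (0 : ℝ) 1) (Set.Ico (0 : ℝ) 1)ᶜ = 0 by simp)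
  rw [l.integral_comp_comm hint, hX] at hle
  exact ⟨t, not_not.1 ht, hle⟩

end ConvexConfiguration

theorem theorem2 (n : ℕ) (C : ConvexConfiguration n)
    (lam lamBar : ℤ → ℤ) (mu : ℕ → ℤ) :
    EveryFaceHasIntegerPoint
      (C.stripConcavePolyhedron (fun j => (lam j : ℝ)) (fun j => (lamBar j : ℝ))
        (fun i => (mu i : ℝ))) := by
  intro F hF hne
  obtain ⟨l, rfl⟩ := hF hne
  obtain ⟨X, hX, hmax⟩ := hne
  obtain ⟨t, ht, hle⟩ := C.exists_le_roundRows l X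
  exact ⟨C.roundRows t X, ⟨ConvexConfiguration.roundRows_mem ht hX,
    fun Y hY => (hmax Y hY).trans hle⟩, ConvexConfiguration.exists_int_roundRows hX t⟩
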